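/- Let $\mathcal L$ be a closed subspace of the real Hilbert space $L^2[0,1]$ and let $F:\mathcal L\times\mathcal L\to\mathbb R$ be a bounded bilinear mapping (bounded: $|F(u,v)|\le C\|u\|\,\|v\|$ for some finite $C$). Let $L\in\{0,1,2,\dots\}\cup\{\infty\}$ be the (Hilbert) dimension of $\mathcal L$, let $(e_i)_{1\le i\le L}$ and $(f_j)_{1\le j\le L}$ (indices running over all positive integers if $L=\infty$) be orthonormal bases of $\mathcal L$, and let $\mathbf F=[F(e_i,f_j)]$ be the corresponding $L\times L$ matrix representation of $F$. For a positive integer $l\le L$ let $\mathbf F_l$ be the $l\times l$ leading principal block of $\mathbf F$. Let $s\in\{0,1,2,\dots\}\cup\{\infty\}$ be the rank of $\mathbf F$, i.e. its number of linearly independent columns ($\infty$ if no finitely many columns span all of them). Call $\mathbf F$ regular if $\mathbf F_j$ is nonsingular for every positive integer $j\le s$. Call $\mathbf F$ strongly regular if either $L<\infty$ and $\mathbf F$ is regular, or $L=\infty$, $\mathbf F$ is diagonal and $\mathbf F_{j,j}\ge \mathbf F_{j+1,j+1}>0$ for all positive integers $j$. For a finite matrix $\mathbf M$ let $\sigma_1(\mathbf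 M)\ge\sigma_2(\mathbf M)\ge\cdots$ be its singular values. For $\mathbf F$, let $\sigma_k(\mathbf F)$ be the $k$-th largest singular value of $\mathbf F$ if $L<\infty$, and $\sigma_k(\mathbf F)=\lim_{l\to\infty}\sigma_k(\mathbf F_l)$ if $L=\infty$. Let $m,n\ge1$ be integers and let $\mathbf H=[\mathbf H_{ij}]$ be a real $m\times n$ matrix. A single-round protocol realizing $\mathbf H$ is a choice of controls $u_1,\dots,u_m\in\mathcal L$ and $v_1,\dots,v_n\in\mathcal L$ with $F(u_i,v_j)=\mathbf H_{ij}$ for all $i,j$; its control cost is $$I=\frac1m\sum_{i=1}^m\int_0^1u_i^2(t)\,dt+\frac1n\sum_{j=1}^n\int_0^1v_j^2(t)\,dt .$$ Theorem. Suppose that $\mathbf F$ is regular and $s\ge\max(m,n)$. Then single-round protocols realizing $\mathbf H$ exist, and the infimum of their control costs is $$\hat C_F(\mathbf H)=\frac{2}{\sqrt{mn}}\sum_{k=1}^{\min(m,n)}\frac{\sigma_k(\mathbf H)}{\sigma_k(\mathbf F)} .$$ If moreover $\mathbf F$ is strongly regular, then some single-round protocol realizing $\mathbf H$ has control cost equal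 to this infimum. -/

import Mathlib

open MeasureTheory Filter Topology

noncomputable section

namespace BilinearControl

/-- The real Hilbert space `L²[0,1]` of square integrable scalar control functions. -/
abbrev L2Controls : Type := Lp ℝ 2 (volume.restrict (Set.Icc (0 : ℝ) 1))

/-- The labels of an orthonormal basis with `L` elements, where `L` is a natural number or `∞`.
Labels start at `0`, so the label `k` stands for the `(k+1)`-st basis element. -/
abbrev BasisIndex (L : ℕ∞) : Type := {k : ℕ // (k : ℕ∞) < L}

/-- A single round protocol with controls in `𝓛`, for a first agent with `m` choices and a second
agent with `n` choices. There is no communication: the control of each agent depends on the choice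
of that agent only. -/
structure SingleRoundProtocol (𝓛 : Submodule ℝ L2Controls) (m n : ℕ) where
  /-- the control used by the first agent, for each of her choices -/
  u : Fin m → 𝓛
  /-- the control used by the second agent, for each of his choices -/
  v : Fin n → 𝓛

namespace SingleRoundProtocol

variable {𝓛 : Submodule ℝ L2Controls} {m n : ℕ}

/-- The protocol realizes the target matrix `H` for the input-output mapping `F`. -/
def Realizes (P : SingleRoundProtocol 𝓛 m n) (F : 𝓛 →L[ℝ] 𝓛 →L[ℝ] ℝ)
    (H : Matrix (Fin m) (Fin n) ℝ) : Prop :=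
  ∀ i j, F (P.u i) (P.v j) = H i j

/-- The control cost: the average control energy over all choices of the two agents. -/
def cost (P : SingleRoundProtocol 𝓛 m n) : ℝ :=
  1 / (m : ℝ) * ∑ i, ∫ t in Set.Icc (0 : ℝ) 1, ((P.u i : L2Controls) t) ^ 2 +
    1 / (n : ℝ) * ∑ j, ∫ t in Set.Icc (0 : ℝ) 1, ((P.v j : L2Controls) t) ^ 2

end SingleRoundProtocol

/-- The matrix representation `[F(e_i, f_j)]` of a bounded bilinear mapping with respect to a pair
of orthonormal (Hilbert) bases. -/
def matrixRep {𝓛 : Submodule ℝ L2Controls} {L : ℕ∞} (F : 𝓛 →L[ℝ] 𝓛 →L[ℝ] ℝ)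
    (e f : HilbertBasis (BasisIndex L) ℝ 𝓛) : Matrix (BasisIndex L) (BasisIndex L) ℝ :=
  Matrix.of fun i j => F (e i) (f j)

variable {L : ℕ∞}

open Classical in
/-- The entry of `A` in row `i` and column `j`; it is `0` when `A` has no such row or column. -/
def entry (A : Matrix (BasisIndex L) (BasisIndex L) ℝ) (i j : ℕ) : ℝ :=
  if h : (i : ℕ∞) < L ∧ (j : ℕ∞) < L then A ⟨i, h.1⟩ ⟨j, h.2⟩ else 0

/-- The `l`-by-`l` leading principal block of `A`, meaningful for `l ≤ L`. -/
def leadingBlock (A : Matrix (BasisIndex L) (BasisIndex L) ℝ) (l : ℕ) :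
    Matrix (Fin l) (Fin l) ℝ :=
  Matrix.of fun i j => entry A i j

/-- `A` is regular: for every positive integer `j` that is at most the rank of `A`, the
`j`-dimensional leading principal block is nonsingular. (`Matrix.eRank` is the number of
independent columns, `⊤` if no finitely many columns span all of them.) -/
def IsRegular (A : Matrix (BasisIndex L) (BasisIndex L) ℝ) : Prop :=
  ∀ j : ℕ, 1 ≤ j → (j : ℕ∞) ≤ A.eRank → (leadingBlock A j).det ≠ 0

/-- `A` is strongly regular: it is finite dimensional and regular, or it is diagonal with
infinitely many diagonal entries, all positive, in nonincreasing order. -/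
def IsStronglyRegular (A : Matrix (BasisIndex L) (BasisIndex L) ℝ) : Prop :=
  (L ≠ ⊤ ∧ IsRegular A) ∨
    (L = ⊤ ∧ A.IsDiag ∧ ∀ j : ℕ, 0 < entry A (j + 1) (j + 1) ∧
      entry A (j + 1) (j + 1) ≤ entry A j j)

/-- The `(k+1)`-st largest singular value of a finite real matrix. -/
def singularValue {p q : ℕ} (M : Matrix (Fin p) (Fin q) ℝ) (k : ℕ) : ℝ :=
  (Matrix.toLpLin 2 2 M).singularValues k

open Classical in
/-- The `(k+1)`-st largest singular value of a matrix representation: the usual one if it is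
finite dimensional (the leading block of size `L` is then the whole matrix), and the limit of the
`(k+1)`-st largest singular values of the leading principal blocks if it is infinite
dimensional. -/
def repSingularValue (A : Matrix (BasisIndex L) (BasisIndex L) ℝ) (k : ℕ) : ℝ :=
  if L = ⊤ then limUnder atTop (fun l : ℕ => singularValue (leadingBlock A l) k)
  else singularValue (leadingBlock A L.toNat) k

end BilinearControl

end

/-!
Choosing singular bases of `H`, one may assume `H` diagonal. Controls `u`, `v` realizing the
diagonal matrix with entries `σ_k(H)` become, after division by these entries, a dual pair of
systems for `F`. In singular coordinates for the restriction of `F` to their spans, the coefficient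
matrices are inverse to each other up to the singular values `b_k` of the restriction, so taking a
trace and applying Cauchy–Schwarz gives `∑ 1 / b_k ≤ ∑ ‖u_k‖ ‖v_k‖`, and `b_k ≤ σ_k(F)`. This holds
for every initial segment of indices, and summation by parts against the decreasing weights `σ_k(H)`
together with AM-GM yields the lower bound for the cost. Conversely, rescaled singular vectors of a
leading block of `F` attain the bound with the singular values of the block in place of those of
`F`; the infimum results as the block grows, and is attained if `F` itself has the singular vectors.
-/

namespace BilinearControl

open Module InnerProductSpace
open Matrix hiding smul_apply sum_apply

noncomputable section

section SingularValues

variable {E E' : Type*} [NormedAddCommGroup E] [InnerProductSpace ℝ E] [FiniteDimensional ℝ E]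
  [NormedAddCommGroup E'] [InnerProductSpace ℝ E'] [FiniteDimensional ℝ E']
  {T : E →ₗ[ℝ] E'} {p q : ℕ}

/-- The vectors of the orthonormal basis `v` are right singular vectors of `T`, numbered in the
order of the singular values. -/
def IsRightSingularBasis (T : E →ₗ[ℝ] E') (v : OrthonormalBasis (Fin q) ℝ E) : Prop :=
  ∀ i j, ⟪T (v i), T (v j)⟫_ℝ = if i = j then T.singularValues j ^ 2 else 0

theorem exists_isRightSingularBasis (T : E →ₗ[ℝ] E') (hq : finrank ℝ E = q) :
    ∃ v : OrthonormalBasis (Fin q) ℝ E, IsRightSingularBasis T v := by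
  refine ⟨T.isSymmetric_adjoint_comp_self.eigenvectorBasis hq, fun i j => ?_⟩
  rw [← LinearMap.adjoint_inner_right, ← LinearMap.comp_apply,
    T.isSymmetric_adjoint_comp_self.apply_eigenvectorBasis hq, inner_smul_right,
    orthonormal_iff_ite.mp (OrthonormalBasis.orthonormal _), T.sq_singularValues_fin hq]
  simp

namespace IsRightSingularBasis

variable {v : OrthonormalBasis (Fin q) ℝ E}

theorem map_eq_zero (hv : IsRightSingularBasis T v) {j : Fin q} (hj : T.singularValues j = 0) :
    T (v j) = 0 := by
  simpa [hj] using hv j j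

theorem sq_norm_map (hv : IsRightSingularBasis T v) (x : E) :
    ‖T x‖ ^ 2 = ∑ j : Fin q, T.singularValues j ^ 2 * ⟪v j, x⟫_ℝ ^ 2 := by
  rw [← real_inner_self_eq_norm_sq]
  conv_lhs => rw [← v.sum_repr' x]
  simp only [map_sum, map_smul, sum_inner, inner_sum, inner_smul_left, inner_smul_right, hv _ _,
    conj_trivial, mul_ite, mul_zero, Finset.sum_ite_eq', Finset.mem_univ, if_true]
  exact Finset.sum_congr rfl fun j _ => by ring

theorem norm_map_le (hv : IsRightSingularBasis T v) {k : ℕ} {x : E}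
    (hx : ∀ j : Fin q, (j : ℕ) < k → ⟪v j, x⟫_ℝ = 0) : ‖T x‖ ≤ T.singularValues k * ‖x‖ := by
  refine le_of_sq_le_sq ?_ (mul_nonneg (T.singularValues_nonneg k) (norm_nonneg x))
  rw [mul_pow, hv.sq_norm_map, ← v.sum_sq_inner_right x, Finset.mul_sum]
  refine Finset.sum_le_sum fun j _ => ?_
  rcases lt_or_ge (j : ℕ) k with hj | hj
  · simp [hx j hj]
  · have := T.singularValues_antitone hj
    have := T.singularValues_nonneg j
    gcongr

theorem le_norm_map (hv : IsRightSingularBasis T v) {k : ℕ} {x : E}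
    (hx : ∀ j : Fin q, k < (j : ℕ) → ⟪v j, x⟫_ℝ = 0) : T.singularValues k * ‖x‖ ≤ ‖T x‖ := by
  refine le_of_sq_le_sq ?_ (norm_nonneg _)
  rw [mul_pow, hv.sq_norm_map, ← v.sum_sq_inner_right x, Finset.mul_sum]
  refine Finset.sum_le_sum fun j _ => ?_
  rcases lt_or_ge k (j : ℕ) with hj | hj
  · simp [hx j hj]
  · have := T.singularValues_antitone hj
    have := T.singularValues_nonneg k
    gcongr

theorem exists_leftSingularBasis (hv : IsRightSingularBasis T v) (hp : finrank ℝ E' = p) :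
    ∃ u : OrthonormalBasis (Fin p) ℝ E', ∀ (i : Fin p) (j : Fin q), (i : ℕ) = j →
      T.singularValues j ≠ 0 → u i = (T.singularValues j)⁻¹ • T (v j) := by
  let s : Set (Fin p) := {i | (i : ℕ) < q ∧ T.singularValues i ≠ 0}
  let w : Fin p → E' := fun i =>
    if h : (i : ℕ) < q then (T.singularValues i)⁻¹ • T (v ⟨i, h⟩) else 0
  have hw : Orthonormal ℝ (s.domRestrict w) := by
    rw [orthonormal_iff_ite]
    rintro ⟨i, hi, hσi⟩ ⟨j, hj, hσj⟩
    simp only [Set.domRestrict_apply, w, hi, hj, dif_pos, inner_smul_left, inner_smul_right,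
      hv _ _, Subtype.mk.injEq, Fin.ext_iff, conj_trivial]
    split_ifs with hij
    · rw [hij]
      field_simp
    · simp
  obtain ⟨u, hu⟩ := hw.exists_orthonormalBasis_extension_of_card_eq (by simpa using hp)
  refine ⟨u, fun i j hij hj => ?_⟩
  have hi : (i : ℕ) < q := hij ▸ j.2
  rw [hu i ⟨hi, hij ▸ hj⟩]
  simp [w, hij]

end IsRightSingularBasis

theorem exists_singularBases (T : E →ₗ[ℝ] E') (hp : finrank ℝ E' = p) (hq : finrank ℝ E = q) :
    ∃ (u : OrthonormalBasis (Fin p) ℝ E') (v : OrthonormalBasis (Fin q) ℝ E),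
      ∀ i j, ⟪u i, T (v j)⟫_ℝ = if (i : ℕ) = j then T.singularValues j else 0 := by
  obtain ⟨v, hv⟩ := exists_isRightSingularBasis T hq
  obtain ⟨u, hu⟩ := hv.exists_leftSingularBasis hp
  refine ⟨u, v, fun i j => ?_⟩
  by_cases hj : T.singularValues j = 0
  · simp [hv.map_eq_zero hj, hj]
  have hjp : (j : ℕ) < p := by
    have hrange := T.singularValues_pos_iff_lt_finrank_range.mp
      ((T.singularValues_pos_iff_ne_zero _).mpr hj)
    exact hp ▸ hrange.trans_le (Submodule.finrank_le (LinearMap.range T))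
  have hTv : T (v j) = T.singularValues j • u ⟨j, hjp⟩ := by
    rw [hu ⟨j, hjp⟩ j rfl hj, smul_inv_smul₀ hj]
  rw [hTv, inner_smul_right, orthonormal_iff_ite.mp u.orthonormal]
  simp [Fin.ext_iff]

theorem exists_ne_zero_forall_eq_zero {U ι : Type*} [AddCommGroup U] [Module ℝ U] [Fintype ι]
    [FiniteDimensional ℝ U] (h : Fintype.card ι < finrank ℝ U) (φ : ι → U →ₗ[ℝ] ℝ) :
    ∃ a ≠ 0, ∀ i, φ i a = 0 := by
  obtain ⟨a, ha, ha0⟩ := (Submodule.ne_bot_iff _).mp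
    (LinearMap.ker_ne_bot_of_finrank_lt (f := LinearMap.pi φ) (by simpa using h))
  exact ⟨a, ha0, congrFun ha⟩

theorem le_singularValues {U : Type*} [NormedAddCommGroup U] [Module ℝ U] [FiniteDimensional ℝ U]
    {k : ℕ} (hk : k < finrank ℝ U) {c : ℝ} (g : U →ₗ[ℝ] E) (hg : ∀ a, ‖g a‖ ≤ ‖a‖)
    (hT : ∀ a, c * ‖a‖ ≤ ‖T (g a)‖) : c ≤ T.singularValues k := by
  obtain ⟨v, hv⟩ := exists_isRightSingularBasis T rfl
  obtain ⟨a, ha, hva⟩ := exists_ne_zero_forall_eq_zero (ι := Fin k) (by simpa using hk)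
    fun j => if h : (j : ℕ) < finrank ℝ E then innerₛₗ ℝ (v ⟨j, h⟩) ∘ₗ g else 0
  have hTa : ‖T (g a)‖ ≤ T.singularValues k * ‖g a‖ :=
    hv.norm_map_le fun j hj => by simpa using hva ⟨j, hj⟩
  refine le_of_mul_le_mul_right ?_ (norm_pos_iff.mpr ha)
  calc c * ‖a‖ ≤ T.singularValues k * ‖g a‖ := (hT a).trans hTa
    _ ≤ T.singularValues k * ‖a‖ :=
      mul_le_mul_of_nonneg_left (hg a) (T.singularValues_nonneg k)

theorem singularValues_le {k : ℕ} {c : ℝ} (hc : 0 ≤ c) (φ : Fin k → E →ₗ[ℝ] ℝ)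
    (hφ : ∀ a, (∀ i, φ i a = 0) → ‖T a‖ ≤ c * ‖a‖) : T.singularValues k ≤ c := by
  rcases le_or_gt (finrank ℝ E) k with hk | hk
  · rwa [T.singularValues_of_finrank_le hk]
  obtain ⟨v, hv⟩ := exists_isRightSingularBasis T rfl
  obtain ⟨a, ha, hφa⟩ := exists_ne_zero_forall_eq_zero
    (ι := Fin k ⊕ Set.Ioi (⟨k, hk⟩ : Fin (finrank ℝ E)))
    (by simp; omega) (Sum.elim φ fun j => innerₛₗ ℝ (v j))
  have hTa : T.singularValues k * ‖a‖ ≤ ‖T a‖ :=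
    hv.le_norm_map fun j hj => hφa (.inr ⟨j, hj⟩)
  exact le_of_mul_le_mul_right (hTa.trans (hφ a fun i => hφa (.inl i))) (norm_pos_iff.mpr ha)

end SingularValues

section Coordinates

variable {V W : Type*} [NormedAddCommGroup V] [InnerProductSpace ℝ V] [NormedAddCommGroup W]
  [InnerProductSpace ℝ W] {ι κ μ ν : Type*} [Fintype ι] [Fintype κ]

theorem singularValue_antitone {p q : ℕ} (M : Matrix (Fin p) (Fin q) ℝ) :
    Antitone (singularValue M) := LinearMap.singularValues_antitone _

theorem singularValue_nonneg {p q : ℕ} (M : Matrix (Fin p) (Fin q) ℝ) (k : ℕ) :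
    0 ≤ singularValue M k := LinearMap.singularValues_nonneg _ _

theorem lt_of_singularValue_pos {p q : ℕ} {M : Matrix (Fin p) (Fin q) ℝ} {k : ℕ}
    (h : 0 < singularValue M k) : k < q := by
  by_contra! hk
  exact h.ne' (LinearMap.singularValues_of_finrank_le _ (by simpa using hk))

/-- The `p`-by-`q` matrix with diagonal entries `d 0, d 1, …` and zeros elsewhere. -/
def rectDiagonal (p q : ℕ) (d : ℕ → ℝ) : Matrix (Fin p) (Fin q) ℝ :=
  .of fun i j => if (i : ℕ) = j then d j else 0

theorem rectDiagonal_self (p : ℕ) (d : ℕ → ℝ) :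
    rectDiagonal p p d = diagonal fun i : Fin p => d i := by
  ext i j
  simp only [rectDiagonal, of_apply, diagonal_apply, ← Fin.ext_iff]
  split_ifs with h <;> simp [h]

theorem inner_toLpLin (M : Matrix ι κ ℝ) (ξ : EuclideanSpace ℝ ι) (η : EuclideanSpace ℝ κ)
    [DecidableEq κ] : ⟪ξ, toLpLin 2 2 M η⟫_ℝ = ∑ i, ∑ j, ξ i * M i j * η j := by
  simp only [PiLp.inner_apply, toLpLin_apply, mulVec, dotProduct, RCLike.inner_apply,
    conj_trivial, Finset.sum_mul]
  exact Finset.sum_congr rfl fun i _ => Finset.sum_congr rfl fun j _ => by ring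

theorem exists_orthogonal_mul_mul_eq_rectDiagonal {p q : ℕ} (M : Matrix (Fin p) (Fin q) ℝ) :
    ∃ P ∈ orthogonalGroup (Fin p) ℝ, ∃ Q ∈ orthogonalGroup (Fin q) ℝ,
      P * M * Qᵀ = rectDiagonal p q (singularValue M) := by
  obtain ⟨u, v, huv⟩ := exists_singularBases (toLpLin 2 2 M) (p := p) (q := q) (by simp) (by simp)
  have horth {r : ℕ} (w : OrthonormalBasis (Fin r) ℝ (EuclideanSpace ℝ (Fin r))) :
      (Matrix.of fun i j => w i j) ∈ orthogonalGroup (Fin r) ℝ := by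
    rw [mem_orthogonalGroup_iff]
    ext i j
    rw [one_apply, ← orthonormal_iff_ite.mp w.orthonormal i j, real_inner_comm]
    simp [mul_apply, PiLp.inner_apply]
  refine ⟨_, horth u, _, horth v, ?_⟩
  ext i j
  rw [rectDiagonal, of_apply, singularValue, ← huv, inner_toLpLin, Finset.sum_comm]
  simp [mul_apply, Finset.sum_mul]

/-- The vector with given coefficients in the family `x`. -/
def synthesis (x : ι → V) : EuclideanSpace ℝ ι →ₗ[ℝ] V :=
  Fintype.linearCombination ℝ x ∘ₗ (WithLp.linearEquiv 2 ℝ (ι → ℝ)).toLinearMap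

/-- The inner products with the vectors of the family `ε`. -/
def analysis (ε : μ → V) : V →ₗ[ℝ] EuclideanSpace ℝ μ :=
  (WithLp.linearEquiv 2 ℝ (μ → ℝ)).symm.toLinearMap ∘ₗ LinearMap.pi fun i => innerₛₗ ℝ (ε i)

/-- For an orthonormal family `ε`, the orthogonal projection onto its span. -/
def spanProjection (ε : ι → V) : V →ₗ[ℝ] V := synthesis ε ∘ₗ analysis ε

/-- The linear combinations of the vectors `x i` with the rows of `M` as coefficients. -/
def combine (M : Matrix μ ι ℝ) (x : ι → V) : μ → V := fun k => ∑ i, M k i • x i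

/-- The matrix of the values of a bilinear form at two families of vectors. -/
def bilinMatrix (F : V →L[ℝ] W →L[ℝ] ℝ) (x : μ → V) (y : ν → W) : Matrix μ ν ℝ :=
  .of fun i j => F (x i) (y j)

theorem synthesis_apply (x : ι → V) (a : EuclideanSpace ℝ ι) :
    synthesis x a = ∑ i, a i • x i := rfl

theorem norm_synthesis {x : ι → V} (hx : Orthonormal ℝ x) (a : EuclideanSpace ℝ ι) :
    ‖synthesis x a‖ = ‖a‖ := by
  rw [← sq_eq_sq₀ (norm_nonneg _) (norm_nonneg _), EuclideanSpace.norm_sq_eq,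
    ← real_inner_self_eq_norm_sq, synthesis_apply, hx.inner_sum]
  exact Finset.sum_congr rfl fun i _ => by simp [sq]

theorem norm_analysis_le {ε : ι → V} (hε : Orthonormal ℝ ε) (z : V) : ‖analysis ε z‖ ≤ ‖z‖ := by
  refine le_of_sq_le_sq ?_ (norm_nonneg z)
  rw [EuclideanSpace.norm_sq_eq]
  exact hε.sum_inner_products_le z

theorem map_synthesis (g : V →ₗ[ℝ] W) (x : ι → V) (a : EuclideanSpace ℝ ι) :
    g (synthesis x a) = synthesis (g ∘ x) a := by
  simp [synthesis_apply]

theorem inner_toLpLin_bilinMatrix [DecidableEq κ] (F : V →L[ℝ] W →L[ℝ] ℝ) (x : ι → V) (y : κ → W)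
    (ξ : EuclideanSpace ℝ ι) (η : EuclideanSpace ℝ κ) :
    ⟪ξ, toLpLin 2 2 (bilinMatrix F x y) η⟫_ℝ = F (synthesis x ξ) (synthesis y η) := by
  simp only [inner_toLpLin, synthesis_apply, bilinMatrix, of_apply, map_sum, map_smul, sum_apply,
    smul_apply, smul_eq_mul, Finset.mul_sum]
  rw [Finset.sum_comm]
  exact Finset.sum_congr rfl fun j _ => Finset.sum_congr rfl fun i _ => by ring

theorem combine_combine (N : Matrix μ κ ℝ) (M : Matrix κ ι ℝ) (x : ι → V) :
    combine N (combine M x) = combine (N * M) x := by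
  ext k
  simp only [combine, Finset.smul_sum, smul_smul, mul_apply, Finset.sum_smul]
  exact Finset.sum_comm

theorem bilinMatrix_combine (F : V →L[ℝ] W →L[ℝ] ℝ) (M : Matrix μ ι ℝ) (N : Matrix ν κ ℝ)
    (x : ι → V) (y : κ → W) :
    bilinMatrix F (combine M x) (combine N y) = M * bilinMatrix F x y * Nᵀ := by
  ext i j
  simp only [bilinMatrix, combine, of_apply, mul_apply, transpose_apply, map_sum, map_smul,
    sum_apply, smul_apply, smul_eq_mul, Finset.mul_sum, Finset.sum_mul]
  exact Finset.sum_congr rfl fun _ _ => Finset.sum_congr rfl fun _ _ => by ring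

theorem inner_combine_combine (B : Matrix μ ι ℝ) (C : Matrix ν ι ℝ) (x : ι → V)
    (hx : Orthonormal ℝ x) (i : μ) (j : ν) :
    ⟪combine B x i, combine C x j⟫_ℝ = (B * Cᵀ) i j := by
  simp [combine, hx.inner_sum, mul_apply]

theorem sq_norm_combine (M : Matrix μ ι ℝ) {x : ι → V} (hx : Orthonormal ℝ x) (i : μ) :
    ‖combine M x i‖ ^ 2 = ∑ k, M i k ^ 2 := by
  rw [← real_inner_self_eq_norm_sq, inner_combine_combine _ _ x hx, mul_apply]
  exact Finset.sum_congr rfl fun k _ => (sq _).symm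

theorem orthonormal_combine [DecidableEq μ] {M : Matrix μ ι ℝ} (hM : M * Mᵀ = 1) {x : ι → V}
    (hx : Orthonormal ℝ x) : Orthonormal ℝ (combine M x) := by
  rw [orthonormal_iff_ite]
  intro i j
  rw [inner_combine_combine _ _ x hx, hM, one_apply]

theorem sum_sq_norm_combine [DecidableEq ι] {M : Matrix κ ι ℝ} (hM : Mᵀ * M = 1) (x : ι → V) :
    ∑ k, ‖combine M x k‖ ^ 2 = ∑ i, ‖x i‖ ^ 2 := by
  have hgram (k : κ) : ‖combine M x k‖ ^ 2 = ∑ i, ∑ j, M k i * M k j * ⟪x i, x j⟫_ℝ := by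
    simp only [← real_inner_self_eq_norm_sq, combine, sum_inner, inner_sum, real_inner_smul_left,
      real_inner_smul_right, ← mul_assoc]
    exact Finset.sum_congr rfl fun _ _ => Finset.sum_congr rfl fun _ _ => by rw [real_inner_comm]
  have hentry (i j : ι) : ∑ k, M k i * M k j = (1 : Matrix ι ι ℝ) i j := by
    rw [← hM, mul_apply]
    rfl
  calc ∑ k, ‖combine M x k‖ ^ 2 = ∑ i, ∑ j, (∑ k, M k i * M k j) * ⟪x i, x j⟫_ℝ := by
        simp only [hgram, Finset.sum_mul]
        rw [Finset.sum_comm]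
        exact Finset.sum_congr rfl fun _ _ => Finset.sum_comm
    _ = ∑ i, ‖x i‖ ^ 2 := by simp [hentry, one_apply]

end Coordinates

section SingularSystems

variable {V W : Type*} [NormedAddCommGroup V] [InnerProductSpace ℝ V] [NormedAddCommGroup W]
  [InnerProductSpace ℝ W] {F : V →L[ℝ] W →L[ℝ] ℝ} {r : ℕ}

/-- A pair of orthonormal families with respect to which the bilinear form `F` is diagonal with
diagonal entries `b`, as in the singular value decomposition of `F`. The families need not span,
and no sign or order is required of `b`. -/
structure IsSingularSystem {ι : Type*} [DecidableEq ι] (F : V →L[ℝ] W →L[ℝ] ℝ) (x : ι → V)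
    (y : ι → W) (b : ι → ℝ) : Prop where
  orthonormal_left : Orthonormal ℝ x
  orthonormal_right : Orthonormal ℝ y
  bilinMatrix_eq : bilinMatrix F x y = diagonal b

theorem IsSingularSystem.comp {ι κ : Type*} [DecidableEq ι] [DecidableEq κ] {x : ι → V}
    {y : ι → W} {b : ι → ℝ} (h : IsSingularSystem F x y b) {g : κ → ι} (hg : g.Injective) :
    IsSingularSystem F (x ∘ g) (y ∘ g) (b ∘ g) where
  orthonormal_left := h.orthonormal_left.comp g hg
  orthonormal_right := h.orthonormal_right.comp g hg
  bilinMatrix_eq := by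
    rw [← submatrix_diagonal b g hg, ← h.bilinMatrix_eq]
    rfl

theorem exists_orthogonal_isSingularSystem (F : V →L[ℝ] W →L[ℝ] ℝ) {x : Fin r → V}
    {y : Fin r → W} (hx : Orthonormal ℝ x) (hy : Orthonormal ℝ y) :
    ∃ P ∈ orthogonalGroup (Fin r) ℝ, ∃ Q ∈ orthogonalGroup (Fin r) ℝ,
      IsSingularSystem F (combine P x) (combine Q y)
        fun i => singularValue (bilinMatrix F x y) i := by
  obtain ⟨P, hP, Q, hQ, hPQ⟩ := exists_orthogonal_mul_mul_eq_rectDiagonal (bilinMatrix F x y)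
  exact ⟨P, hP, Q, hQ, orthonormal_combine ((mem_orthogonalGroup_iff ..).mp hP) hx,
    orthonormal_combine ((mem_orthogonalGroup_iff ..).mp hQ) hy, by
      rw [bilinMatrix_combine, hPQ, rectDiagonal_self]⟩

theorem exists_orthonormal_eq_combine {u : Fin r → V} (hu : LinearIndependent ℝ u) :
    ∃ (x : Fin r → V) (S : Matrix (Fin r) (Fin r) ℝ), Orthonormal ℝ x ∧ u = combine S x := by
  have : FiniteDimensional ℝ (Submodule.span ℝ (Set.range u)) :=
    .span_of_finite ℝ (Set.finite_range u)
  let x := (stdOrthonormalBasis ℝ (Submodule.span ℝ (Set.range u))).reindex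
    (finCongr ((finrank_span_eq_card hu).trans (Fintype.card_fin r)))
  refine ⟨fun i => x i, .of fun i k => ⟪(x k : V), u i⟫_ℝ,
    x.orthonormal.comp_linearIsometry (Submodule.subtypeₗᵢ _), funext fun i => ?_⟩
  have := congrArg Subtype.val (x.sum_repr' ⟨u i, Submodule.subset_span ⟨i, rfl⟩⟩)
  simpa [combine] using this.symm

theorem linearIndependent_of_bilinMatrix_eq_one {u : Fin r → V} {w : Fin r → W}
    (huw : bilinMatrix F u w = 1) : LinearIndependent ℝ u ∧ LinearIndependent ℝ w := by
  have hF (i j : Fin r) : F (u i) (w j) = if i = j then 1 else 0 := congrFun₂ huw i j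
  refine ⟨Fintype.linearIndependent_iff.mpr fun g hg i => ?_,
    Fintype.linearIndependent_iff.mpr fun g hg i => ?_⟩
  · simpa [hF] using congrArg (fun z => F z (w i)) hg
  · simpa [hF] using congrArg (fun z => F (u i) z) hg

theorem sum_mul_le_norm_combine_mul_norm_combine {x : Fin r → V}
    (hx : Orthonormal ℝ x) {y : Fin r → W} (hy : Orthonormal ℝ y)
    (S N : Matrix (Fin r) (Fin r) ℝ) (i : Fin r) :
    ∑ k, S i k * N i k ≤ ‖combine S x i‖ * ‖combine N y i‖ := by
  rw [← Real.sqrt_sq (norm_nonneg (combine S x i)), ← Real.sqrt_sq (norm_nonneg (combine N y i)),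
    sq_norm_combine S hx, sq_norm_combine N hy]
  exact Real.sum_mul_le_sqrt_mul_sqrt _ _ _

theorem mul_sum_eq_one_of_mul_diagonal_mul_eq_one {S N : Matrix (Fin r) (Fin r) ℝ} {b : Fin r → ℝ}
    (h : S * diagonal b * Nᵀ = 1) (k : Fin r) : b k * ∑ i, S i k * N i k = 1 := by
  rw [mul_assoc, mul_eq_one_comm, mul_assoc] at h
  rw [← one_apply_eq k, ← h, diagonal_mul, mul_apply]
  congr! 2 with i
  exact mul_comm _ _

/-- In coordinates with respect to the singular system, duality says that the coefficient matrices
of `u` and `w` are inverse to each other up to the diagonal factor `b`. Hence `∑ (b k)⁻¹` is the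
trace of their product, and Cauchy–Schwarz applies. -/
theorem exists_isSingularSystem_sum_inv_le {u : Fin r → V} {w : Fin r → W}
    (huw : bilinMatrix F u w = 1) :
    ∃ (x : Fin r → V) (y : Fin r → W) (b : Fin r → ℝ), IsSingularSystem F x y b ∧ Antitone b ∧
      (∀ k, 0 < b k) ∧ ∑ k, (b k)⁻¹ ≤ ∑ i, ‖u i‖ * ‖w i‖ := by
  obtain ⟨hu, hw⟩ := linearIndependent_of_bilinMatrix_eq_one huw
  obtain ⟨ε, S, hε, rfl⟩ := exists_orthonormal_eq_combine hu
  obtain ⟨φ, N, hφ, rfl⟩ := exists_orthonormal_eq_combine hw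
  obtain ⟨P, hP, Q, hQ, hsys⟩ := exists_orthogonal_isSingularSystem F hε hφ
  set b : Fin r → ℝ := fun i => singularValue (bilinMatrix F ε φ) i
  have hε' : combine S ε = combine (S * Pᵀ) (combine P ε) := by
    rw [combine_combine, mul_assoc, (mem_orthogonalGroup_iff' ..).mp hP, mul_one]
  have hφ' : combine N φ = combine (N * Qᵀ) (combine Q φ) := by
    rw [combine_combine, mul_assoc, (mem_orthogonalGroup_iff' ..).mp hQ, mul_one]
  rw [hε', hφ'] at huw ⊢
  rw [bilinMatrix_combine, hsys.bilinMatrix_eq] at huw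
  have hb (k : Fin r) := mul_sum_eq_one_of_mul_diagonal_mul_eq_one huw k
  refine ⟨_, _, b, hsys, fun i j hij => singularValue_antitone _ hij,
    fun k => (singularValue_nonneg _ _).lt_of_ne' (left_ne_zero_of_mul_eq_one (hb k)), ?_⟩
  simp only [fun k => inv_eq_of_mul_eq_one_right (hb k)]
  rw [Finset.sum_comm]
  exact Finset.sum_le_sum fun i _ => sum_mul_le_norm_combine_mul_norm_combine
    hsys.orthonormal_left hsys.orthonormal_right _ _ i

end SingularSystems

section Compressions

variable {V W : Type*} [NormedAddCommGroup V] [InnerProductSpace ℝ V] [NormedAddCommGroup W]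
  [InnerProductSpace ℝ W] {F : V →L[ℝ] W →L[ℝ] ℝ} {l : ℕ} {ε : Fin l → V} {φ : Fin l → W}

theorem abs_inner_toLpLin_le {ι : Type*} [Fintype ι] [DecidableEq ι] (D : Matrix ι ι ℝ)
    (a : EuclideanSpace ℝ ι) : |⟪a, toLpLin 2 2 D a⟫_ℝ| ≤ (∑ i, ∑ j, |D i j|) * ‖a‖ ^ 2 := by
  rw [inner_toLpLin, Finset.sum_mul]
  refine (Finset.abs_sum_le_sum_abs _ _).trans (Finset.sum_le_sum fun i _ => ?_)
  rw [Finset.sum_mul]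
  refine (Finset.abs_sum_le_sum_abs _ _).trans (Finset.sum_le_sum fun j _ => ?_)
  have hi : |a i| ≤ ‖a‖ := PiLp.norm_apply_le a i
  have hj : |a j| ≤ ‖a‖ := PiLp.norm_apply_le a j
  calc |a i * D i j * a j| = |D i j| * (|a i| * |a j|) := by rw [abs_mul, abs_mul]; ring
    _ ≤ |D i j| * (‖a‖ * ‖a‖) := by gcongr
    _ = |D i j| * ‖a‖ ^ 2 := by rw [sq]

theorem le_inner_toLpLin_diagonal {ι : Type*} [Fintype ι] [DecidableEq ι] {b : ι → ℝ} {c : ℝ}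
    (hc : ∀ i, c ≤ b i) (a : EuclideanSpace ℝ ι) :
    c * ‖a‖ ^ 2 ≤ ⟪a, toLpLin 2 2 (diagonal b) a⟫_ℝ := by
  simp only [inner_toLpLin, diagonal_apply, mul_ite, ite_mul, mul_zero, zero_mul,
    Finset.sum_ite_eq, Finset.mem_univ, if_true]
  rw [EuclideanSpace.norm_sq_eq, Finset.mul_sum]
  refine Finset.sum_le_sum fun i _ => ?_
  rw [Real.norm_eq_abs, sq_abs]
  nlinarith [hc i, sq_nonneg (a i)]

theorem singularValue_bilinMatrix_le_norm (hε : Orthonormal ℝ ε) (hφ : Orthonormal ℝ φ) (k : ℕ) :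
    singularValue (bilinMatrix F ε φ) k ≤ ‖F‖ := by
  refine (singularValue_antitone _ (Nat.zero_le k)).trans
    (singularValues_le (norm_nonneg F) Fin.elim0 fun a _ => ?_)
  set Ta := toLpLin 2 2 (bilinMatrix F ε φ) a with hTa
  have hsq : ‖Ta‖ * ‖Ta‖ ≤ ‖F‖ * ‖a‖ * ‖Ta‖ :=
    calc ‖Ta‖ * ‖Ta‖ = F (synthesis ε Ta) (synthesis φ a) := by
          rw [← inner_toLpLin_bilinMatrix, ← hTa, real_inner_self_eq_norm_mul_norm]
      _ ≤ ‖F‖ * ‖synthesis ε Ta‖ * ‖synthesis φ a‖ :=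
          (le_abs_self _).trans (F.le_opNorm₂ _ _)
      _ = ‖F‖ * ‖a‖ * ‖Ta‖ := by rw [norm_synthesis hε, norm_synthesis hφ, mul_right_comm]
  rcases (norm_nonneg Ta).eq_or_lt with h0 | hpos
  · rw [← h0]
    positivity
  · exact le_of_mul_le_mul_right hsq hpos

/-- The error term measures the failure of `x` and `y` to lie in the spans of `ε` and `φ`. -/
theorem IsSingularSystem.sub_le_singularValue_bilinMatrix {k : ℕ} {x : Fin (k + 1) → V}
    {y : Fin (k + 1) → W} {b : Fin (k + 1) → ℝ} (h : IsSingularSystem F x y b) {c : ℝ}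
    (hc : ∀ i, c ≤ b i) (hε : Orthonormal ℝ ε) (hφ : Orthonormal ℝ φ) :
    c - ∑ i, ∑ j, |F (spanProjection ε (x i)) (spanProjection φ (y j)) - F (x i) (y j)| ≤
      singularValue (bilinMatrix F ε φ) k := by
  set D := bilinMatrix F (spanProjection ε ∘ x) (spanProjection φ ∘ y) - bilinMatrix F x y
  change c - ∑ i, ∑ j, |D i j| ≤ _
  refine le_singularValues (U := EuclideanSpace ℝ (Fin (k + 1))) (by simp)
    (analysis φ ∘ₗ synthesis y)
    (fun a => (norm_analysis_le hφ _).trans_eq (norm_synthesis h.orthonormal_right a)) fun a => ?_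
  set Tg := toLpLin 2 2 (bilinMatrix F ε φ) ((analysis φ ∘ₗ synthesis y) a)
  have hform : ⟪analysis ε (synthesis x a), Tg⟫_ℝ = ⟪a, toLpLin 2 2 (diagonal b + D) a⟫_ℝ := by
    rw [← h.bilinMatrix_eq, add_sub_cancel, inner_toLpLin_bilinMatrix, inner_toLpLin_bilinMatrix,
      ← map_synthesis, ← map_synthesis]
    rfl
  have hnorm : ⟪analysis ε (synthesis x a), Tg⟫_ℝ ≤ ‖a‖ * ‖Tg‖ := by
    refine (real_inner_le_norm _ _).trans ?_
    gcongr
    exact (norm_analysis_le hε _).trans_eq (norm_synthesis h.orthonormal_left a)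
  have hbound : (c - ∑ i, ∑ j, |D i j|) * ‖a‖ ^ 2 ≤ ‖a‖ * ‖Tg‖ := by
    rw [hform, map_add, LinearMap.add_apply, inner_add_right] at hnorm
    linarith [le_inner_toLpLin_diagonal hc a, neg_le_of_abs_le (abs_inner_toLpLin_le D a)]
  rcases (norm_nonneg a).eq_or_lt with h0 | hpos
  · rw [← h0, mul_zero]
    exact norm_nonneg _
  · exact le_of_mul_le_mul_left (by linarith) hpos

end Compressions

section PaddedBases

variable {V : Type*} [NormedAddCommGroup V] [InnerProductSpace ℝ V] {L : ℕ∞}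
  (e : HilbertBasis (BasisIndex L) ℝ V)

open Classical in
/-- A Hilbert basis indexed by an initial segment of `ℕ`, extended by zero to all of `ℕ`. -/
def paddedBasis (i : ℕ) : V := if h : (i : ℕ∞) < L then e ⟨i, h⟩ else 0

/-- The first `l` vectors of a Hilbert basis, padded with zeros if there are fewer. -/
def leadingVectors (l : ℕ) : Fin l → V := fun i => paddedBasis e i

theorem paddedBasis_of_lt {i : ℕ} (h : (i : ℕ∞) < L) : paddedBasis e i = e ⟨i, h⟩ := dif_pos h

theorem paddedBasis_of_le {i : ℕ} (h : L ≤ i) : paddedBasis e i = 0 := dif_neg h.not_gt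

theorem orthonormal_leadingVectors {l : ℕ} (hl : (l : ℕ∞) ≤ L) :
    Orthonormal ℝ (leadingVectors e l) := by
  have hlt (i : Fin l) : ((i : ℕ) : ℕ∞) < L := (Nat.cast_lt.mpr i.2).trans_le hl
  convert e.orthonormal.comp (fun i : Fin l => (⟨i, hlt i⟩ : BasisIndex L)) fun i j hij =>
    Fin.ext (congrArg Subtype.val hij) using 1
  exact funext fun i => paddedBasis_of_lt e (hlt i)

theorem hasSum_paddedBasis (z : V) :
    HasSum (fun i : ℕ => ⟪paddedBasis e i, z⟫_ℝ • paddedBasis e i) z := by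
  rw [← Function.Injective.hasSum_iff (Subtype.val_injective (p := fun k : ℕ => (k : ℕ∞) < L))]
  · convert e.hasSum_repr z using 2 with i
    rw [Function.comp_apply, paddedBasis_of_lt e i.2, e.repr_apply_apply]
  · intro i hi
    rw [paddedBasis_of_le e (not_lt.mp fun h => hi ⟨⟨i, h⟩, rfl⟩), smul_zero]

theorem spanProjection_leadingVectors (l : ℕ) (z : V) :
    spanProjection (leadingVectors e l) z =
      ∑ i ∈ Finset.range l, ⟪paddedBasis e i, z⟫_ℝ • paddedBasis e i :=
  (Finset.sum_range fun i => ⟪paddedBasis e i, z⟫_ℝ • paddedBasis e i).symm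

theorem tendsto_spanProjection_leadingVectors (z : V) :
    Tendsto (fun l => spanProjection (leadingVectors e l) z) atTop (𝓝 z) := by
  simpa only [spanProjection_leadingVectors] using (hasSum_paddedBasis e z).tendsto_sum_nat

theorem spanProjection_leadingVectors_eq_self {l : ℕ} (hl : L ≤ l) (z : V) :
    spanProjection (leadingVectors e l) z = z := by
  rw [spanProjection_leadingVectors]
  refine (hasSum_sum_of_ne_finset_zero fun i hi => ?_).unique (hasSum_paddedBasis e z)
  have hli : (l : ℕ∞) ≤ i := Nat.cast_le.mpr (by simpa using hi)
  rw [paddedBasis_of_le e (hl.trans hli), smul_zero]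

end PaddedBases

section RepSingularValues

variable {V W : Type*} [NormedAddCommGroup V] [InnerProductSpace ℝ V] [NormedAddCommGroup W]
  [InnerProductSpace ℝ W] {F : V →L[ℝ] W →L[ℝ] ℝ} {L : ℕ∞}
  {e : HilbertBasis (BasisIndex L) ℝ V} {f : HilbertBasis (BasisIndex L) ℝ W} {r : ℕ}
  {x : Fin r → V} {y : Fin r → W} {b : Fin r → ℝ}

theorem entry_bilinMatrix (i j : ℕ) :
    entry (bilinMatrix F e f) i j = F (paddedBasis e i) (paddedBasis f j) := by
  unfold entry
  split_ifs with h
  · rw [paddedBasis_of_lt e h.1, paddedBasis_of_lt f h.2]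
    rfl
  · rcases not_and_or.mp h with h | h
    · simp [paddedBasis_of_le e (not_lt.mp h)]
    · simp [paddedBasis_of_le f (not_lt.mp h)]

theorem leadingBlock_bilinMatrix (l : ℕ) :
    leadingBlock (bilinMatrix F e f) l =
      bilinMatrix F (leadingVectors e l) (leadingVectors f l) := by
  ext i j
  exact entry_bilinMatrix i j

theorem repSingularValue_of_ne_top (hL : L ≠ ⊤) (A : Matrix (BasisIndex L) (BasisIndex L) ℝ) :
    repSingularValue A = singularValue (leadingBlock A L.toNat) :=
  funext fun _ => if_neg hL

theorem IsSingularSystem.eventually_lt_singularValue_leadingBlock (hL : L = ⊤)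
    (h : IsSingularSystem F x y b) (hb : Antitone b) (k : Fin r) {a : ℝ} (ha : a < b k) :
    ∀ᶠ l in atTop, a < singularValue (leadingBlock (bilinMatrix F e f) l) k := by
  let g : Fin (k + 1) → Fin r := Fin.castLE k.2
  have herror : Tendsto (fun l => b k - ∑ i, ∑ j,
      |F (spanProjection (leadingVectors e l) (x (g i)))
        (spanProjection (leadingVectors f l) (y (g j))) - F (x (g i)) (y (g j))|)
      atTop (𝓝 (b k - ∑ i, ∑ j, |F (x (g i)) (y (g j)) - F (x (g i)) (y (g j))|)) := by
    have hF : Continuous fun p : V × W => F p.1 p.2 := by fun_prop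
    refine tendsto_const_nhds.sub (tendsto_finsetSum _ fun i _ => tendsto_finsetSum _ fun j _ => ?_)
    exact (((hF.tendsto (x (g i), y (g j))).comp
      ((tendsto_spanProjection_leadingVectors e _).prodMk_nhds
        (tendsto_spanProjection_leadingVectors f _))).sub_const _).abs
  simp only [sub_self, abs_zero, Finset.sum_const_zero, sub_zero] at herror
  filter_upwards [herror.eventually_const_lt ha] with l hl
  rw [leadingBlock_bilinMatrix]
  exact hl.trans_le ((h.comp (Fin.castLE_injective k.2)).sub_le_singularValue_bilinMatrix
    (fun i => hb (Nat.lt_succ_iff.mp i.2)) (orthonormal_leadingVectors e (by simp [hL]))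
    (orthonormal_leadingVectors f (by simp [hL])))

theorem IsSingularSystem.le_singularValue_leadingBlock (hL : L ≠ ⊤)
    (h : IsSingularSystem F x y b) (hb : Antitone b) (k : Fin r) :
    b k ≤ singularValue (leadingBlock (bilinMatrix F e f) L.toNat) k := by
  have hN : ((L.toNat : ℕ) : ℕ∞) = L := ENat.natCast_toNat hL
  rw [leadingBlock_bilinMatrix]
  simpa [spanProjection_leadingVectors_eq_self _ hN.ge] using
    (h.comp (Fin.castLE_injective k.2)).sub_le_singularValue_bilinMatrix
      (fun i => hb (Nat.lt_succ_iff.mp i.2)) (orthonormal_leadingVectors e hN.le)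
      (orthonormal_leadingVectors f hN.le)

theorem exists_isSingularSystem_leadingBlock (F : V →L[ℝ] W →L[ℝ] ℝ)
    (e : HilbertBasis (BasisIndex L) ℝ V) (f : HilbertBasis (BasisIndex L) ℝ W) {l : ℕ}
    (hl : (l : ℕ∞) ≤ L) : ∃ (x : Fin l → V) (y : Fin l → W), IsSingularSystem F x y
      fun i => singularValue (leadingBlock (bilinMatrix F e f) l) i := by
  obtain ⟨P, -, Q, -, h⟩ := exists_orthogonal_isSingularSystem F
    (orthonormal_leadingVectors e hl) (orthonormal_leadingVectors f hl)
  rw [leadingBlock_bilinMatrix]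
  exact ⟨_, _, h⟩

theorem eventually_lt_singularValue_leadingBlock_of_lt (hL : L = ⊤) {a : ℝ} {k l : ℕ}
    (ha : a < singularValue (leadingBlock (bilinMatrix F e f) l) k) :
    ∀ᶠ l' in atTop, a < singularValue (leadingBlock (bilinMatrix F e f) l') k := by
  rcases lt_or_ge a 0 with h0 | h0
  · exact .of_forall fun l' => h0.trans_le (singularValue_nonneg _ k)
  · obtain ⟨x, y, h⟩ := exists_isSingularSystem_leadingBlock F e f (l := l) (by simp [hL])
    exact h.eventually_lt_singularValue_leadingBlock hL
      (fun i j hij => singularValue_antitone _ hij) ⟨k, lt_of_singularValue_pos (h0.trans_lt ha)⟩ ha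

theorem tendsto_singularValue_leadingBlock (hL : L = ⊤) (k : ℕ) :
    Tendsto (fun l => singularValue (leadingBlock (bilinMatrix F e f) l) k) atTop
      (𝓝 (repSingularValue (bilinMatrix F e f) k)) := by
  have hbdd : BddAbove (Set.range fun l => singularValue (leadingBlock (bilinMatrix F e f) l) k) :=
    ⟨‖F‖, by
      rintro _ ⟨l, rfl⟩
      simp only [leadingBlock_bilinMatrix]
      exact singularValue_bilinMatrix_le_norm (orthonormal_leadingVectors e (by simp [hL]))
        (orthonormal_leadingVectors f (by simp [hL])) k⟩
  have hsup : Tendsto (fun l => singularValue (leadingBlock (bilinMatrix F e f) l) k) atTop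
      (𝓝 (⨆ l, singularValue (leadingBlock (bilinMatrix F e f) l) k)) := by
    refine tendsto_order.mpr ⟨fun a ha => ?_, fun a ha => ?_⟩
    · obtain ⟨l, hl⟩ := exists_lt_of_lt_ciSup ha
      exact eventually_lt_singularValue_leadingBlock_of_lt hL hl
    · exact .of_forall fun l => (le_ciSup hbdd l).trans_lt ha
  rw [repSingularValue, if_pos hL, hsup.limUnder_eq]
  exact hsup

theorem IsSingularSystem.le_repSingularValue (h : IsSingularSystem F x y b) (hb : Antitone b)
    (k : Fin r) : b k ≤ repSingularValue (bilinMatrix F e f) k := by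
  by_cases hL : L = ⊤
  · refine le_of_forall_lt_imp_le_of_dense fun a ha => ?_
    exact ge_of_tendsto (tendsto_singularValue_leadingBlock hL k)
      ((h.eventually_lt_singularValue_leadingBlock hL hb k ha).mono fun l => le_of_lt)
  · rw [repSingularValue_of_ne_top hL]
    exact h.le_singularValue_leadingBlock hL hb k

end RepSingularValues

section DualSystems

variable {V W : Type*} [NormedAddCommGroup V] [InnerProductSpace ℝ V] [NormedAddCommGroup W]
  [InnerProductSpace ℝ W] {F : V →L[ℝ] W →L[ℝ] ℝ} {r : ℕ}

theorem exists_linearIndependent_flip_of_le_eRank {ι κ : Type*} {x : ι → V} {y : κ → W}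
    (hr : (r : ℕ∞) ≤ (bilinMatrix F x y).eRank) :
    ∃ w : Fin r → W, LinearIndependent ℝ fun k => F.flip (w k) := by
  let Φ : W →ₗ[ℝ] ι → ℝ := LinearMap.pi fun i => (F (x i)).toLinearMap
  have hspan : Submodule.span ℝ (Set.range (bilinMatrix F x y).col) ≤ LinearMap.range Φ :=
    Submodule.span_le.mpr (Set.range_subset_iff.mpr fun j => ⟨y j, rfl⟩)
  obtain ⟨c, hc⟩ := Module.le_rank_iff.mp
    ((Cardinal.natCast_le_toENat.mp hr).trans (Submodule.rank_mono hspan))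
  choose w hw using fun k => LinearMap.mem_range.mp (c k).2
  let values : (V →L[ℝ] ℝ) →ₗ[ℝ] ι → ℝ :=
    LinearMap.pi fun i => (ContinuousLinearMap.apply ℝ ℝ (x i)).toLinearMap
  have hvalues : values ∘ (fun k => F.flip (w k)) = fun k => (c k : ι → ℝ) := funext hw
  refine ⟨w, .of_comp values ?_⟩
  rw [hvalues]
  exact hc.map' (Submodule.subtype _) (Submodule.ker_subtype _)

theorem exists_bilinMatrix_eq_one {w : Fin r → W}
    (hw : LinearIndependent ℝ fun k => F.flip (w k)) : ∃ u : Fin r → V, bilinMatrix F u w = 1 := by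
  let G : V →ₗ[ℝ] Fin r → ℝ := LinearMap.pi fun k => (F.flip (w k)).toLinearMap
  have hG : Function.Surjective G := by
    rw [← LinearMap.dualMap_injective_iff, ← LinearMap.ker_eq_bot, LinearMap.ker_eq_bot']
    intro φ hφ
    have hcomb : ∑ k, (φ fun j => if k = j then 1 else 0) • F.flip (w k) = 0 := by
      ext v
      have hv := LinearMap.congr_fun hφ v
      rw [LinearMap.dualMap_apply, LinearMap.pi_apply_eq_sum_univ] at hv
      simpa [G, mul_comm] using hv
    have hcoeff := Fintype.linearIndependent_iff.mp hw _ hcomb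
    refine LinearMap.ext fun ξ => ?_
    rw [LinearMap.pi_apply_eq_sum_univ φ ξ]
    simp [hcoeff]
  choose u hu using fun k => hG ((1 : Matrix (Fin r) (Fin r) ℝ) k)
  exact ⟨u, funext hu⟩

variable {L : ℕ∞} {e : HilbertBasis (BasisIndex L) ℝ V} {f : HilbertBasis (BasisIndex L) ℝ W}
  {u : Fin r → V} {w : Fin r → W}

theorem repSingularValue_pos_of_bilinMatrix_eq_one (huw : bilinMatrix F u w = 1) (k : Fin r) :
    0 < repSingularValue (bilinMatrix F e f) k := by
  obtain ⟨x, y, b, hsys, hb, hpos, -⟩ := exists_isSingularSystem_sum_inv_le huw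
  exact (hpos k).trans_le (hsys.le_repSingularValue hb k)

theorem repSingularValue_pos {k : ℕ} (hk : ((k + 1 : ℕ) : ℕ∞) ≤ (bilinMatrix F e f).eRank) :
    0 < repSingularValue (bilinMatrix F e f) k := by
  obtain ⟨w, hw⟩ := exists_linearIndependent_flip_of_le_eRank hk
  obtain ⟨u, huw⟩ := exists_bilinMatrix_eq_one hw
  exact repSingularValue_pos_of_bilinMatrix_eq_one huw (Fin.last k)

theorem sum_inv_repSingularValue_le (huw : bilinMatrix F u w = 1) :
    ∑ k : Fin r, (repSingularValue (bilinMatrix F e f) k)⁻¹ ≤ ∑ i, ‖u i‖ * ‖w i‖ := by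
  obtain ⟨x, y, b, hsys, hb, hpos, hsum⟩ := exists_isSingularSystem_sum_inv_le huw
  refine le_trans (Finset.sum_le_sum fun k _ => ?_) hsum
  exact inv_anti₀ (hpos k) (hsys.le_repSingularValue hb k)

theorem sum_mul_le_sum_mul_of_antitone {h a c : ℕ → ℝ} {p : ℕ} (hh : Antitone h)
    (h0 : ∀ k, 0 ≤ h k) (hac : ∀ k < p, 0 < h k →
      ∑ i ∈ Finset.range (k + 1), a i ≤ ∑ i ∈ Finset.range (k + 1), c i) :
    ∑ k ∈ Finset.range p, h k * a k ≤ ∑ k ∈ Finset.range p, h k * c k := by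
  have key : ∀ q ≤ p, ∀ t, 0 ≤ t → (∀ k < q, t ≤ h k) →
      t * ∑ k ∈ Finset.range q, (c k - a k) ≤ ∑ k ∈ Finset.range q, h k * (c k - a k) := by
    intro q
    induction q with
    | zero => simp
    | succ q ih =>
      intro hq t ht hth
      have hmul : t * ∑ k ∈ Finset.range (q + 1), (c k - a k) ≤
          h q * ∑ k ∈ Finset.range (q + 1), (c k - a k) := by
        rcases (h0 q).eq_or_lt with hq0 | hq0
        · rw [← hq0, le_antisymm (hq0 ▸ hth q q.lt_succ_self) ht]
        · refine mul_le_mul_of_nonneg_right (hth q q.lt_succ_self) ?_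
          rw [Finset.sum_sub_distrib]
          exact sub_nonneg.mpr (hac q hq hq0)
      have hprev := ih (by omega) (h q) (h0 q) fun k hk => hh hk.le
      rw [Finset.sum_range_succ, mul_add] at hmul
      rw [Finset.sum_range_succ, mul_add, Finset.sum_range_succ]
      linarith
  have hfinal := key p le_rfl 0 le_rfl fun k _ => h0 k
  simpa only [zero_mul, mul_sub, Finset.sum_sub_distrib, sub_zero, sub_nonneg] using hfinal

theorem sum_div_repSingularValue_le {h : ℕ → ℝ} {p : ℕ} (hh : Antitone h) (h0 : ∀ k, 0 ≤ h k)
    {u : ℕ → V} {w : ℕ → W}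
    (huw : ∀ i < p, ∀ j < p, F (u i) (w j) = if i = j then h j else 0) :
    ∑ k ∈ Finset.range p, h k / repSingularValue (bilinMatrix F e f) k ≤
      ∑ k ∈ Finset.range p, ‖u k‖ * ‖w k‖ := by
  have hpartial (k : ℕ) (hk : k < p) (hpos : 0 < h k) :
      ∑ i ∈ Finset.range (k + 1), (repSingularValue (bilinMatrix F e f) i)⁻¹ ≤
        ∑ i ∈ Finset.range (k + 1), ‖u i‖ * ‖w i‖ / h i := by
    have hne (i : Fin (k + 1)) : 0 < h i := hpos.trans_le (hh (Nat.lt_succ_iff.mp i.2))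
    have hdual : bilinMatrix F (fun i : Fin (k + 1) => u i)
        (fun j : Fin (k + 1) => (h j)⁻¹ • w j) = 1 := by
      ext i j
      simp [bilinMatrix, huw i (by omega) j (by omega), one_apply, Fin.ext_iff, (hne j).ne']
    refine (Finset.sum_range _).trans_le ((sum_inv_repSingularValue_le hdual).trans_eq ?_)
    rw [Finset.sum_range]
    refine Finset.sum_congr rfl fun i _ => ?_
    rw [norm_smul, norm_inv, Real.norm_of_nonneg (h0 i)]
    ring
  calc ∑ k ∈ Finset.range p, h k / repSingularValue (bilinMatrix F e f) k
      ≤ ∑ k ∈ Finset.range p, h k * (‖u k‖ * ‖w k‖ / h k) :=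
        sum_mul_le_sum_mul_of_antitone hh h0 hpartial
    _ ≤ ∑ k ∈ Finset.range p, ‖u k‖ * ‖w k‖ := by
        refine Finset.sum_le_sum fun k _ => ?_
        rw [mul_div_left_comm]
        exact mul_le_of_le_one_right (by positivity) (div_self_le_one _)

end DualSystems

section ExtendByZero

variable {V : Type*} [Zero V] {r : ℕ}

/-- A finite sequence of vectors, continued by zeros. -/
def extendByZero (x : Fin r → V) (k : ℕ) : V := if h : k < r then x ⟨k, h⟩ else 0

@[simp]
theorem extendByZero_coe (x : Fin r → V) (i : Fin r) : extendByZero x i = x i := dif_pos i.2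

theorem extendByZero_of_lt {k : ℕ} (x : Fin r → V) (hk : k < r) : extendByZero x k = x ⟨k, hk⟩ :=
  dif_pos hk

theorem extendByZero_of_le {k : ℕ} (x : Fin r → V) (hk : r ≤ k) : extendByZero x k = 0 :=
  dif_neg hk.not_gt

end ExtendByZero

section AverageEnergy

variable {V W : Type*} [NormedAddCommGroup V] [NormedAddCommGroup W] {m n : ℕ}

/-- The control cost of a protocol with controls `u` and `v`. -/
def averageEnergy (u : Fin m → V) (v : Fin n → W) : ℝ :=
  1 / (m : ℝ) * ∑ i, ‖u i‖ ^ 2 + 1 / (n : ℝ) * ∑ j, ‖v j‖ ^ 2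

theorem two_div_sqrt_mul_le (hm : 0 < m) (hn : 0 < n) (a b : ℝ) :
    2 / √((m : ℝ) * n) * (a * b) ≤ 1 / (m : ℝ) * a ^ 2 + 1 / (n : ℝ) * b ^ 2 := by
  have hm' : (0 : ℝ) < m := Nat.cast_pos.mpr hm
  have hn' : (0 : ℝ) < n := Nat.cast_pos.mpr hn
  calc 2 / √((m : ℝ) * n) * (a * b) = 2 * (a / √m) * (b / √n) := by
        rw [Real.sqrt_mul hm'.le]
        ring
    _ ≤ (a / √m) ^ 2 + (b / √n) ^ 2 := two_mul_le_add_sq _ _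
    _ = 1 / (m : ℝ) * a ^ 2 + 1 / (n : ℝ) * b ^ 2 := by
        rw [div_pow, div_pow, Real.sq_sqrt hm'.le, Real.sq_sqrt hn'.le]
        ring

theorem two_div_sqrt_mul_sum_le_averageEnergy (hm : 0 < m) (hn : 0 < n) (u : Fin m → V)
    (v : Fin n → W) :
    2 / √((m : ℝ) * n) * ∑ k ∈ Finset.range (min m n), ‖extendByZero u k‖ * ‖extendByZero v k‖ ≤
      averageEnergy u v := by
  calc 2 / √((m : ℝ) * n) *
        ∑ k ∈ Finset.range (min m n), ‖extendByZero u k‖ * ‖extendByZero v k‖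
      ≤ 1 / (m : ℝ) * ∑ k ∈ Finset.range (min m n), ‖extendByZero u k‖ ^ 2 +
        1 / (n : ℝ) * ∑ k ∈ Finset.range (min m n), ‖extendByZero v k‖ ^ 2 := by
        simp only [Finset.mul_sum, ← Finset.sum_add_distrib]
        exact Finset.sum_le_sum fun k _ => two_div_sqrt_mul_le hm hn _ _
    _ ≤ 1 / (m : ℝ) * ∑ k ∈ Finset.range m, ‖extendByZero u k‖ ^ 2 +
        1 / (n : ℝ) * ∑ k ∈ Finset.range n, ‖extendByZero v k‖ ^ 2 := by
        gcongr
        · exact min_le_left m n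
        · exact min_le_right m n
    _ = averageEnergy u v := by simp only [averageEnergy, Finset.sum_range, extendByZero_coe]

end AverageEnergy

section Costs

variable {V W : Type*} [NormedAddCommGroup V] [InnerProductSpace ℝ V] [NormedAddCommGroup W]
  [InnerProductSpace ℝ W] {F : V →L[ℝ] W →L[ℝ] ℝ} {m n : ℕ}

/-- The control costs of the single-round protocols realizing `H`, for a bilinear form `F` on
arbitrary spaces of controls. -/
def realizationCosts (F : V →L[ℝ] W →L[ℝ] ℝ) (H : Matrix (Fin m) (Fin n) ℝ) : Set ℝ :=
  {c | ∃ u v, bilinMatrix F u v = H ∧ averageEnergy u v = c}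

/-- The minimal cost of realizing a target with singular values `h` by a form with singular
values `d`. -/
def balancedCost (m n : ℕ) (h d : ℕ → ℝ) : ℝ :=
  2 / √((m : ℝ) * n) * ∑ k ∈ Finset.range (min m n), h k / d k

theorem realizationCosts_subset_mul_mul_transpose {P : Matrix (Fin m) (Fin m) ℝ}
    {Q : Matrix (Fin n) (Fin n) ℝ} (hP : Pᵀ * P = 1) (hQ : Qᵀ * Q = 1)
    (H : Matrix (Fin m) (Fin n) ℝ) :
    realizationCosts F H ⊆ realizationCosts F (P * H * Qᵀ) := by
  rintro _ ⟨u, v, rfl, rfl⟩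
  exact ⟨combine P u, combine Q v, bilinMatrix_combine F P Q u v, by
    simp only [averageEnergy, sum_sq_norm_combine hP, sum_sq_norm_combine hQ]⟩

theorem realizationCosts_eq_rectDiagonal (H : Matrix (Fin m) (Fin n) ℝ) :
    realizationCosts F H = realizationCosts F (rectDiagonal m n (singularValue H)) := by
  obtain ⟨P, hP, Q, hQ, hH⟩ := exists_orthogonal_mul_mul_eq_rectDiagonal H
  rw [mem_orthogonalGroup_iff'] at hP hQ
  have hinv : Pᵀ * rectDiagonal m n (singularValue H) * Qᵀᵀ = H := by
    rw [← hH, transpose_transpose, Matrix.mul_assoc P, ← Matrix.mul_assoc, hP, Matrix.one_mul,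
      Matrix.mul_assoc, hQ, Matrix.mul_one]
  refine Set.Subset.antisymm ?_ ?_
  · rw [← hH]
    exact realizationCosts_subset_mul_mul_transpose hP hQ H
  · conv_rhs => rw [← hinv]
    exact realizationCosts_subset_mul_mul_transpose
      (by rw [transpose_transpose, mul_eq_one_comm.mp hP])
      (by rw [transpose_transpose, mul_eq_one_comm.mp hQ]) _

theorem norm_extendByZero {r k : ℕ} {x : Fin r → V} (hx : Orthonormal ℝ x) (hk : k < r) :
    ‖extendByZero x k‖ = 1 := by
  rw [extendByZero_of_lt x hk, hx.1]

theorem balancedCost_mem_lowerBounds {L : ℕ∞} {e : HilbertBasis (BasisIndex L) ℝ V}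
    {f : HilbertBasis (BasisIndex L) ℝ W} (hm : 0 < m) (hn : 0 < n)
    (H : Matrix (Fin m) (Fin n) ℝ) :
    balancedCost m n (singularValue H) (repSingularValue (bilinMatrix F e f)) ∈
      lowerBounds (realizationCosts F H) := by
  rw [realizationCosts_eq_rectDiagonal]
  rintro _ ⟨u, v, huv, rfl⟩
  refine le_trans ?_ (two_div_sqrt_mul_sum_le_averageEnergy hm hn u v)
  refine mul_le_mul_of_nonneg_left (sum_div_repSingularValue_le (singularValue_antitone H)
    (singularValue_nonneg H) fun i hi j hj => ?_) (by positivity)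
  rw [lt_min_iff] at hi hj
  rw [extendByZero_of_lt u hi.1, extendByZero_of_lt v hj.2]
  exact congrFun₂ huv ⟨i, hi.1⟩ ⟨j, hj.2⟩

theorem sum_sq_norm_smul_extendByZero {r p : ℕ} (hrp : r ≤ p) {x : Fin r → V}
    (hx : Orthonormal ℝ x) (s : ℕ → ℝ) :
    ∑ i : Fin p, ‖s i • extendByZero x i‖ ^ 2 = ∑ k ∈ Finset.range r, s k ^ 2 := by
  rw [← Finset.sum_range fun k => ‖s k • extendByZero x k‖ ^ 2]
  rw [← Finset.sum_subset (Finset.range_mono hrp) fun k _ hk => ?_]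
  · refine Finset.sum_congr rfl fun k hk => ?_
    rw [norm_smul, norm_extendByZero hx (Finset.mem_range.mp hk), mul_one, Real.norm_eq_abs, sq_abs]
  · simp [extendByZero_of_le x (by simpa using hk)]

theorem IsSingularSystem.bilinMatrix_smul_extendByZero {x : Fin (min m n) → V}
    {y : Fin (min m n) → W} {d h α β : ℕ → ℝ} (hsys : IsSingularSystem F x y fun k => d k)
    (hαβ : ∀ k < min m n, α k * β k * d k = h k) :
    bilinMatrix F (fun i : Fin m => α i • extendByZero x i)
      (fun j : Fin n => β j • extendByZero y j) = rectDiagonal m n h := by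
  ext i j
  simp only [bilinMatrix, rectDiagonal, of_apply, map_smul, smul_apply, smul_eq_mul]
  by_cases hi : (i : ℕ) < min m n
  · by_cases hj : (j : ℕ) < min m n
    · have hF : F (x ⟨i, hi⟩) (y ⟨j, hj⟩) = if (i : ℕ) = j then d i else 0 := by
        simpa [bilinMatrix, diagonal_apply] using congrFun₂ hsys.bilinMatrix_eq ⟨i, hi⟩ ⟨j, hj⟩
      rw [extendByZero_of_lt x hi, extendByZero_of_lt y hj, hF]
      split_ifs with hij
      · rw [← hij, ← hαβ i hi]
        ring
      · simp
    · rw [extendByZero_of_le y (not_lt.mp hj), if_neg (by omega), map_zero, mul_zero, mul_zero]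
  · rw [extendByZero_of_le x (not_lt.mp hi), if_neg (by omega), map_zero, _root_.zero_apply,
      mul_zero, mul_zero]

theorem balancedCost_eq (hm : 0 < m) (hn : 0 < n) (h d : ℕ → ℝ) : balancedCost m n h d =
      1 / (m : ℝ) * ∑ k ∈ Finset.range (min m n), h k / d k * (√m / √n) +
      1 / (n : ℝ) * ∑ k ∈ Finset.range (min m n), h k / d k * (√n / √m) := by
  have hm' : (0 : ℝ) < m := Nat.cast_pos.mpr hm
  have hn' : (0 : ℝ) < n := Nat.cast_pos.mpr hn
  have hfactor : 2 / √((m : ℝ) * n) = 1 / m * (√m / √n) + 1 / n * (√n / √m) := by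
    have hsm := Real.sq_sqrt hm'.le
    have hsn := Real.sq_sqrt hn'.le
    rw [Real.sqrt_mul hm'.le]
    field_simp
    rw [hsm, hsn]
    ring
  rw [balancedCost, hfactor, ← Finset.sum_mul, ← Finset.sum_mul]
  ring

/-- Scaling the `k`-th pair of the singular system by `√(h k / d k)` realizes the target; the factor
`√m / √n` shifts energy between the two agents to reach equality in AM-GM. -/
theorem IsSingularSystem.balancedCost_mem_realizationCosts (hm : 0 < m) (hn : 0 < n)
    {x : Fin (min m n) → V} {y : Fin (min m n) → W} {d : ℕ → ℝ}
    (hsys : IsSingularSystem F x y fun k => d k) (hd : ∀ k < min m n, 0 < d k)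
    (H : Matrix (Fin m) (Fin n) ℝ) :
    balancedCost m n (singularValue H) d ∈ realizationCosts F H := by
  rw [realizationCosts_eq_rectDiagonal]
  set h := singularValue H
  have hscale : √(m : ℝ) / √n * (√n / √m) = 1 := by
    rw [div_mul_div_comm, mul_comm, div_self (by positivity)]
  have hq (k : ℕ) (hk : k < min m n) : 0 ≤ h k / d k :=
    div_nonneg (singularValue_nonneg H k) (hd k hk).le
  let α (k : ℕ) : ℝ := √(h k / d k * (√m / √n))
  let β (k : ℕ) : ℝ := √(h k / d k * (√n / √m))
  have hα (k : ℕ) (hk : k < min m n) : α k ^ 2 = h k / d k * (√m / √n) :=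
    Real.sq_sqrt (mul_nonneg (hq k hk) (by positivity))
  have hβ (k : ℕ) (hk : k < min m n) : β k ^ 2 = h k / d k * (√n / √m) :=
    Real.sq_sqrt (mul_nonneg (hq k hk) (by positivity))
  have hαβ (k : ℕ) (hk : k < min m n) : α k * β k * d k = h k := by
    have hsq : (α k * β k) ^ 2 = (h k / d k) ^ 2 := by
      rw [mul_pow, hα k hk, hβ k hk, mul_mul_mul_comm, hscale, mul_one, sq]
    rw [(sq_eq_sq₀ (by positivity) (hq k hk)).mp hsq, div_mul_cancel₀ _ (hd k hk).ne']
  refine ⟨_, _, hsys.bilinMatrix_smul_extendByZero hαβ, ?_⟩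
  rw [averageEnergy, sum_sq_norm_smul_extendByZero (min_le_left m n) hsys.orthonormal_left,
    sum_sq_norm_smul_extendByZero (min_le_right m n) hsys.orthonormal_right,
    balancedCost_eq hm hn, Finset.sum_congr rfl fun k hk => hα k (Finset.mem_range.mp hk),
    Finset.sum_congr rfl fun k hk => hβ k (Finset.mem_range.mp hk)]

end Costs

section Attainment

variable {V W : Type*} [NormedAddCommGroup V] [InnerProductSpace ℝ V] [NormedAddCommGroup W]
  [InnerProductSpace ℝ W] {F : V →L[ℝ] W →L[ℝ] ℝ} {L : ℕ∞}
  {e : HilbertBasis (BasisIndex L) ℝ V} {f : HilbertBasis (BasisIndex L) ℝ W} {m n : ℕ}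

theorem balancedCost_leadingBlock_mem_realizationCosts (hm : 0 < m) (hn : 0 < n) {l : ℕ}
    (hl : (l : ℕ∞) ≤ L)
    (hpos : ∀ k < min m n, 0 < singularValue (leadingBlock (bilinMatrix F e f) l) k)
    (H : Matrix (Fin m) (Fin n) ℝ) :
    balancedCost m n (singularValue H) (singularValue (leadingBlock (bilinMatrix F e f) l)) ∈
      realizationCosts F H := by
  have hmnl : min m n ≤ l := by
    have := lt_of_singularValue_pos (hpos (min m n - 1) (by omega))
    omega
  obtain ⟨x, y, hsys⟩ := exists_isSingularSystem_leadingBlock F e f hl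
  exact (hsys.comp (Fin.castLE_injective hmnl)).balancedCost_mem_realizationCosts hm hn hpos H

theorem isGLB_realizationCosts_of_eq_top (hL : L = ⊤) (hm : 0 < m) (hn : 0 < n)
    (hpos : ∀ k < min m n, 0 < repSingularValue (bilinMatrix F e f) k)
    (H : Matrix (Fin m) (Fin n) ℝ) :
    IsGLB (realizationCosts F H)
      (balancedCost m n (singularValue H) (repSingularValue (bilinMatrix F e f))) := by
  refine ⟨balancedCost_mem_lowerBounds hm hn H, fun c hc => ?_⟩
  have hlim : Tendsto (fun l => balancedCost m n (singularValue H)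
      (singularValue (leadingBlock (bilinMatrix F e f) l))) atTop
      (𝓝 (balancedCost m n (singularValue H) (repSingularValue (bilinMatrix F e f)))) :=
    (tendsto_finsetSum _ fun k hk => tendsto_const_nhds.div
      (tendsto_singularValue_leadingBlock hL k) (hpos k (Finset.mem_range.mp hk)).ne').const_mul _
  have hev : ∀ᶠ l in atTop, ∀ k ∈ Finset.range (min m n),
      0 < singularValue (leadingBlock (bilinMatrix F e f) l) k :=
    (Finset.eventually_all _).mpr fun k hk =>
      (tendsto_singularValue_leadingBlock hL k).eventually_const_lt
        (hpos k (Finset.mem_range.mp hk))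
  refine ge_of_tendsto hlim (hev.mono fun l hl => hc ?_)
  exact balancedCost_leadingBlock_mem_realizationCosts hm hn (by simp [hL])
    (fun k hk => hl k (Finset.mem_range.mpr hk)) H

theorem isSingularSystem_leadingVectors_of_isDiag (hA : (bilinMatrix F e f).IsDiag) {l : ℕ}
    (hl : (l : ℕ∞) ≤ L) : IsSingularSystem F (leadingVectors e l) (leadingVectors f l)
      fun i => entry (bilinMatrix F e f) i i where
  orthonormal_left := orthonormal_leadingVectors e hl
  orthonormal_right := orthonormal_leadingVectors f hl
  bilinMatrix_eq := by
    have hlt (i : Fin l) : ((i : ℕ) : ℕ∞) < L := (Nat.cast_lt.mpr i.2).trans_le hl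
    rw [← leadingBlock_bilinMatrix]
    ext i j
    rw [diagonal_apply]
    split_ifs with hij
    · rw [hij]
      rfl
    · rw [leadingBlock, of_apply, entry, dif_pos ⟨hlt i, hlt j⟩]
      exact hA (by simpa [Fin.ext_iff] using hij)

theorem singularValue_diagonal_le {l : ℕ} {d : ℕ → ℝ} (hd : Antitone d) (h0 : ∀ k, 0 ≤ d k)
    (k : ℕ) : singularValue (diagonal fun i : Fin l => d i) k ≤ d k := by
  refine singularValues_le (h0 k) (fun j : Fin k => if h : (j : ℕ) < l then
    (EuclideanSpace.proj ⟨j, h⟩ : EuclideanSpace ℝ (Fin l) →L[ℝ] ℝ).toLinearMap else 0)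
    fun a ha => ?_
  refine le_of_sq_le_sq ?_ (mul_nonneg (h0 k) (norm_nonneg _))
  rw [mul_pow, EuclideanSpace.norm_sq_eq, EuclideanSpace.norm_sq_eq, Finset.mul_sum]
  refine Finset.sum_le_sum fun i _ => ?_
  rw [toLpLin_apply, PiLp.toLp_apply, mulVec_diagonal, norm_mul, mul_pow,
    Real.norm_of_nonneg (h0 i)]
  rcases lt_or_ge (i : ℕ) k with hik | hik
  · have hi : a i = 0 := by simpa using ha ⟨i, hik⟩
    simp [hi]
  · have := hd hik
    have := h0 i
    gcongr

theorem repSingularValue_eq_entry (hL : L = ⊤) (hA : (bilinMatrix F e f).IsDiag)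
    (hanti : Antitone fun k => entry (bilinMatrix F e f) k k)
    (h0 : ∀ k, 0 ≤ entry (bilinMatrix F e f) k k) (k : ℕ) :
    repSingularValue (bilinMatrix F e f) k = entry (bilinMatrix F e f) k k := by
  have hsys (l : ℕ) := isSingularSystem_leadingVectors_of_isDiag hA (l := l) (by simp [hL])
  refine le_antisymm (le_of_tendsto' (tendsto_singularValue_leadingBlock hL k) fun l => ?_)
    ((hsys (k + 1)).le_repSingularValue (fun i j hij => hanti hij) (Fin.last k))
  rw [leadingBlock_bilinMatrix, (hsys l).bilinMatrix_eq]
  exact singularValue_diagonal_le hanti h0 k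

theorem balancedCost_mem_realizationCosts_of_isDiag (hL : L = ⊤) (hm : 0 < m) (hn : 0 < n)
    (hA : (bilinMatrix F e f).IsDiag) (hanti : Antitone fun k => entry (bilinMatrix F e f) k k)
    (hpos : ∀ k, 0 < entry (bilinMatrix F e f) k k) (H : Matrix (Fin m) (Fin n) ℝ) :
    balancedCost m n (singularValue H) (repSingularValue (bilinMatrix F e f)) ∈
      realizationCosts F H := by
  rw [funext (repSingularValue_eq_entry hL hA hanti fun k => (hpos k).le)]
  have hsys := isSingularSystem_leadingVectors_of_isDiag hA (l := min m n) (by simp [hL])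
  exact hsys.balancedCost_mem_realizationCosts hm hn (fun k _ => hpos k) H

theorem balancedCost_mem_realizationCosts_of_ne_top (hL : L ≠ ⊤) (hm : 0 < m) (hn : 0 < n)
    (hpos : ∀ k < min m n, 0 < repSingularValue (bilinMatrix F e f) k)
    (H : Matrix (Fin m) (Fin n) ℝ) :
    balancedCost m n (singularValue H) (repSingularValue (bilinMatrix F e f)) ∈
      realizationCosts F H := by
  rw [repSingularValue_of_ne_top hL] at hpos ⊢
  exact balancedCost_leadingBlock_mem_realizationCosts hm hn (ENat.natCast_toNat hL).le hpos H

end Attainment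

section Protocols

variable {𝓛 : Submodule ℝ L2Controls} {m n : ℕ}

theorem integral_sq_eq_norm_sq (g : L2Controls) :
    ∫ t in Set.Icc (0 : ℝ) 1, (g t) ^ 2 = ‖g‖ ^ 2 := by
  rw [← real_inner_self_eq_norm_sq, L2.inner_def]
  refine integral_congr_ae (Eventually.of_forall fun t => ?_)
  simp [sq]

theorem integral_sq_add_const (g : L2Controls) (c : ℝ) :
    ∫ t in Set.Icc (0 : ℝ) 1, ((g t) ^ 2 + c) = ‖g‖ ^ 2 + c := by
  rw [integral_add (Lp.memLp g).integrable_sq (integrable_const c), integral_sq_eq_norm_sq]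
  simp

/-- The integral sign in `SingleRoundProtocol.cost` extends over the second summand, which is
constant in the integration variable; as `[0,1]` has measure one, the cost is the sum of the two
average energies nevertheless. -/
theorem SingleRoundProtocol.cost_eq_averageEnergy (P : SingleRoundProtocol 𝓛 m n) (hm : 0 < m) :
    P.cost = averageEnergy P.u P.v := by
  have hm' : (m : ℝ) ≠ 0 := Nat.cast_ne_zero.mpr hm.ne'
  simp only [SingleRoundProtocol.cost, averageEnergy, integral_sq_eq_norm_sq,
    integral_sq_add_const, Submodule.coe_norm, Finset.sum_add_distrib, Finset.sum_const,
    Finset.card_univ, Fintype.card_fin, nsmul_eq_mul]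
  field_simp

theorem setOf_cost_eq_realizationCosts (hm : 0 < m) (F : 𝓛 →L[ℝ] 𝓛 →L[ℝ] ℝ)
    (H : Matrix (Fin m) (Fin n) ℝ) :
    {c | ∃ P : SingleRoundProtocol 𝓛 m n, P.Realizes F H ∧ P.cost = c} = realizationCosts F H := by
  ext c
  constructor
  · rintro ⟨P, hP, rfl⟩
    exact ⟨P.u, P.v, Matrix.ext hP, (P.cost_eq_averageEnergy hm).symm⟩
  · rintro ⟨u, v, huv, rfl⟩
    exact ⟨⟨u, v⟩, congrFun₂ huv, SingleRoundProtocol.cost_eq_averageEnergy _ hm⟩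

end Protocols

end

end BilinearControl

open BilinearControl in
theorem theorem5p1_general {V W : Type*} [NormedAddCommGroup V] [InnerProductSpace ℝ V]
    [NormedAddCommGroup W] [InnerProductSpace ℝ W] (F : V →L[ℝ] W →L[ℝ] ℝ) {L : ℕ∞}
    (e : HilbertBasis (BasisIndex L) ℝ V) (f : HilbertBasis (BasisIndex L) ℝ W) {m n : ℕ}
    (hm : 0 < m) (hn : 0 < n) (hmn : ((min m n : ℕ) : ℕ∞) ≤ (bilinMatrix F e f).eRank)
    (H : Matrix (Fin m) (Fin n) ℝ) :
    IsGLB (realizationCosts F H)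
      (balancedCost m n (singularValue H) (repSingularValue (bilinMatrix F e f))) ∧
    (L ≠ ⊤ ∨ IsStronglyRegular (bilinMatrix F e f) →
      balancedCost m n (singularValue H) (repSingularValue (bilinMatrix F e f)) ∈
        realizationCosts F H) := by
  have hpos (k : ℕ) (hk : k < min m n) : 0 < repSingularValue (bilinMatrix F e f) k :=
    repSingularValue_pos ((Nat.cast_le.mpr hk).trans hmn)
  have hfinite (hL : L ≠ ⊤) := balancedCost_mem_realizationCosts_of_ne_top hL hm hn hpos H
  constructor
  · by_cases hL : L = ⊤
    · exact isGLB_realizationCosts_of_eq_top hL hm hn hpos H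
    · exact ⟨balancedCost_mem_lowerBounds hm hn H, fun c hc => hc (hfinite hL)⟩
  · rintro (hL | ⟨hL, -⟩ | ⟨hL, hdiag, hentry⟩)
    · exact hfinite hL
    · exact hfinite hL
    · exact balancedCost_mem_realizationCosts_of_isDiag hL hm hn hdiag
        (antitone_nat_of_succ_le fun k => (hentry k).2)
        (fun k => (hentry k).1.trans_le (hentry k).2) H

theorem theorem5p1
    (𝓛 : Submodule ℝ BilinearControl.L2Controls)
    (_h𝓛 : IsClosed (𝓛 : Set BilinearControl.L2Controls))
    (F : 𝓛 →L[ℝ] 𝓛 →L[ℝ] ℝ)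
    (L : ℕ∞) (e f : HilbertBasis (BilinearControl.BasisIndex L) ℝ 𝓛)
    (hreg : BilinearControl.IsRegular (BilinearControl.matrixRep F e f))
    (s : ℕ∞) (hs : (BilinearControl.matrixRep F e f).eRank = s)
    (m n : ℕ) (hm : 0 < m) (hn : 0 < n)
    (hmn : ((max m n : ℕ) : ℕ∞) ≤ s)
    (H : Matrix (Fin m) (Fin n) ℝ) :
    IsGLB {c : ℝ | ∃ P : BilinearControl.SingleRoundProtocol 𝓛 m n,
        P.Realizes F H ∧ P.cost = c}
      (2 / √((m : ℝ) * (n : ℝ)) *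
        ∑ k ∈ Finset.range (min m n),
          BilinearControl.singularValue H k /
            BilinearControl.repSingularValue (BilinearControl.matrixRep F e f) k) ∧
    (BilinearControl.IsStronglyRegular (BilinearControl.matrixRep F e f) →
      ∃ P : BilinearControl.SingleRoundProtocol 𝓛 m n,
        P.Realizes F H ∧
        P.cost = 2 / √((m : ℝ) * (n : ℝ)) *
          ∑ k ∈ Finset.range (min m n),
            BilinearControl.singularValue H k /
              BilinearControl.repSingularValue (BilinearControl.matrixRep F e f) k) := by
  obtain ⟨hglb, hattained⟩ := theorem5p1_general F e f hm hn
    ((Nat.cast_le.mpr (min_le_max (a := m) (b := n))).trans (hmn.trans hs.ge)) H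
  rw [← BilinearControl.setOf_cost_eq_realizationCosts hm] at hglb hattained
  exact ⟨hglb, fun hstrong => hattained (.inr hstrong)⟩
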